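/- Write $\mathfrak c=2^{\aleph_0}$. For a (nonempty, preordered) poset $\mathbb Q$, "the conclusion of Martin's Axiom holds for $\mathbb Q$" means: for every family $\mathcal D$ of fewer than $\mathfrak c$ dense subsets of $\mathbb Q$ there is a filter on $\mathbb Q$ meeting every member of $\mathcal D$. Let $\mathrm{ZFC}^-$ be $\mathrm{ZFC}$ without the power set axiom, axiomatized with the collection scheme and with choice as the well-ordering principle, and let $H_{\kappa^+}$ be the collection of sets whose transitive closure has size at most $\kappa$. The *local grounded Martin's Axiom* (local grMA) asserts that there are a cardinal $\kappa\ge\mathfrak c$ and a transitive model $M\subseteq H_{\kappa^+}$ of $\mathrm{ZFC}^-$ such that 1. $H_{\kappa^+}$ is a ccc forcing extension of $M$, i.e. there are a poset $\mathbb P\in M$ that is ccc in $M$ and an $M$-generic filter $G\subseteq\mathbb P$ with $H_{\kappa^+}=M[G]=\{\tau^G:\tau\in M\text{ a }\mathbb P\text{-name}\}$, and 2. the conclusion of Martin's Axiom holds (in $V$) for every poset $\mathbb Q\in M$ that is ccc in $V$. For a cardinal $\lambda$, $\mathrm{Add}(\omega,\lambda)$ is the poset of finite partial functions from $\lambda\times\omega$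 to $2$, ordered by reverse inclusion. $\mathrm{MA}(\mathrm{Cohen})$ asserts that the conclusion of Martin's Axiom holds for $\mathrm{Add}(\omega,\lambda)$ for every cardinal $\lambda$. **Proposition.** The local grounded Martin's Axiom implies $\mathrm{MA}(\mathrm{Cohen})$. -/

import Mathlib

open Cardinal

universe u

/-! ### Forcing notions, chain condition, generic filters -/

namespace Forcing

variable {P : Type*} [Preorder P]

/-- Two conditions are compatible if they have a common extension (stronger means smaller). -/
def Compatible (p q : P) : Prop := ∃ r, r ≤ p ∧ r ≤ q

/-- A set of conditions is dense if every condition has an extension in it. -/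
def IsDense (D : Set P) : Prop := ∀ p, ∃ d ∈ D, d ≤ p

/-- A set of pairwise incompatible conditions (an antichain in the sense of forcing). -/
def IsForcingAntichain (A : Set P) : Prop := A.Pairwise fun p q => ¬ Compatible p q

variable (P)

/-- The countable chain condition. -/
def CCC : Prop := ∀ A : Set P, IsForcingAntichain A → A.Countable

/-- The conclusion of Martin's Axiom for `P`: for every family `𝒟` of fewer than continuum many
dense subsets of `P` there is a filter on `P` meeting all of them. -/
def MartinConclusion : Prop :=
  ∀ 𝒟 : Set (Set P), #𝒟 < 𝔠 → (∀ D ∈ 𝒟, IsDense D) →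
    ∃ G : Order.PFilter P, ∀ D ∈ 𝒟, ∃ p ∈ G, p ∈ D

end Forcing

/-! ### The Cohen posets `Add(ω, lam)` -/

/-- `Add(ω, lam)`: the finite partial functions from `lam × ω` to `2`. A partial function is given
by its values, `none` standing for "undefined". -/
def CohenPoset (lam : Cardinal.{u}) : Type u :=
  {p : lam.ord.ToType × ℕ → Option Bool // {x | p x ≠ none}.Finite}

/-- `q ≤ p` iff `q` extends `p` as a partial function. -/
instance (lam : Cardinal.{u}) : Preorder (CohenPoset lam) where
  le q p := ∀ x b, p.1 x = some b → q.1 x = some b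
  le_refl _ _ _ h := h
  le_trans _ _ _ h₁ h₂ x b h := h₁ x b (h₂ x b h)

/-- `MA(Cohen)`: Martin's Axiom for all posets of the form `Add(ω, lam)` (which are always ccc). -/
def MACohen : Prop :=
  ∀ lam : Cardinal.{u}, Forcing.MartinConclusion (CohenPoset lam)

/-! ### The theory ZFC⁻ -/

namespace SetLang

/-- The only non-logical symbol of set theory is the binary relation symbol `∈`. -/
inductive RelSymbol : ℕ → Type
  | mem : RelSymbol 2

/-- The first-order language of set theory. -/
def lang : FirstOrder.Language := ⟨fun _ => Empty, RelSymbol⟩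

/-- A type with a binary relation, as a structure for the language of set theory. -/
abbrev struc {N : Type*} (E : N → N → Prop) : lang.Structure N where
  funMap f := f.elim
  RelMap r v := match r with
    | RelSymbol.mem => E (v 0) (v 1)

/-- Truth in `(N, E)` of a first-order formula with free variables `0, …, k - 1`. -/
def Sat {N : Type*} (E : N → N → Prop) {k : ℕ} (φ : lang.Formula (Fin k)) (v : Fin k → N) : Prop :=
  @FirstOrder.Language.Formula.Realize lang N (struc E) (Fin k) φ v

/-- In `(N, E)`, `p` is the Kuratowski pair `{{a}, {a, b}}`. -/
def IsPairIn {N : Type*} (E : N → N → Prop) (p a b : N) : Prop :=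
  ∀ z, E z p ↔ (∀ w, E w z ↔ w = a) ∨ (∀ w, E w z ↔ w = a ∨ w = b)

/-- In `(N, E)`, the pair of `a` and `b` belongs to `r`. -/
def RelIn {N : Type*} (E : N → N → Prop) (r a b : N) : Prop :=
  ∃ p, E p r ∧ IsPairIn E p a b

/-- `(N, E)` is a model of `ZFC⁻`, that is, ZFC without the power set axiom, axiomatized with the
collection scheme and with the well-ordering principle as the axiom of choice. -/
structure ModelsZFCMinus {N : Type*} (E : N → N → Prop) : Prop where
  extensionality : ∀ x y, (∀ z, E z x ↔ E z y) → x = y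
  foundation : ∀ x, (∃ y, E y x) → ∃ y, E y x ∧ ∀ z, E z x → ¬ E z y
  pairing : ∀ x y, ∃ z, ∀ w, E w z ↔ w = x ∨ w = y
  union : ∀ x, ∃ y, ∀ z, E z y ↔ ∃ w, E w x ∧ E z w
  infinity : ∃ x, (∃ e, E e x ∧ ∀ y, ¬ E y e) ∧
    ∀ y, E y x → ∃ s, E s x ∧ ∀ z, E z s ↔ E z y ∨ z = y
  separation : ∀ (k : ℕ) (φ : lang.Formula (Fin (k + 1))) (v : Fin k → N) (a : N),
    ∃ b, ∀ x, E x b ↔ E x a ∧ Sat E φ (Fin.cons x v)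
  collection : ∀ (k : ℕ) (φ : lang.Formula (Fin (k + 2))) (v : Fin k → N) (a : N),
    (∀ x, E x a → ∃ y, Sat E φ (Fin.cons x (Fin.cons y v))) →
      ∃ b, ∀ x, E x a → ∃ y, E y b ∧ Sat E φ (Fin.cons x (Fin.cons y v))
  wellOrdering : ∀ x, ∃ r,
    (∀ a, E a x → ¬ RelIn E r a a) ∧
    (∀ a b c, E a x → E b x → E c x → RelIn E r a b → RelIn E r b c → RelIn E r a c) ∧
    (∀ a b, E a x → E b x → RelIn E r a b ∨ a = b ∨ RelIn E r b a) ∧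
    (∀ y, (∀ a, E a y → E a x) → (∃ a, E a y) → ∃ m, E m y ∧ ∀ a, E a y → ¬ RelIn E r a m)

end SetLang

/-! ### Forcing over set models; the universe `V` is `ZFSet` -/

/-- A nonempty preordered set in `V`, given by its underlying set and its order relation. -/
structure SetPoset where
  carrier : ZFSet.{u}
  rel : ZFSet.{u}
  rel_subset : rel ⊆ ZFSet.prod carrier carrier
  nonempty : carrier.Nonempty
  refl : ∀ p ∈ carrier, ZFSet.pair p p ∈ rel
  trans : ∀ p q r, ZFSet.pair p q ∈ rel → ZFSet.pair q r ∈ rel → ZFSet.pair p r ∈ rel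

namespace SetPoset

/-- The type of conditions of a poset in `V`. -/
def Cond (P : SetPoset.{u}) : Type (u + 1) := {p : ZFSet.{u} // p ∈ P.carrier}

instance (P : SetPoset.{u}) : Preorder P.Cond where
  le p q := ZFSet.pair p.1 q.1 ∈ P.rel
  le_refl p := P.refl p.1 p.2
  le_trans p q r := P.trans p.1 q.1 r.1

/-- The poset `P`, that is, the pair of its underlying set and its order, is an element of `M`. -/
def MemModel (P : SetPoset.{u}) (M : ZFSet.{u}) : Prop := ZFSet.pair P.carrier P.rel ∈ M

/-- The conditions of `P` that belong to the set `A`. -/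
def condsIn (P : SetPoset.{u}) (A : ZFSet.{u}) : Set P.Cond := {p | p.1 ∈ A}

/-- `P` is ccc in the sense of the transitive model `M`: every antichain of `P` that is an element
of `M` is mapped injectively into `ω` by a function that is an element of `M`. -/
def CCCIn (P : SetPoset.{u}) (M : ZFSet.{u}) : Prop :=
  ∀ A ∈ M, A ⊆ P.carrier → Forcing.IsForcingAntichain (P.condsIn A) →
    ∃ f ∈ M, ZFSet.IsFunc A ZFSet.omega f ∧
      ∀ a b n, ZFSet.pair a n ∈ f → ZFSet.pair b n ∈ f → a = b

/-- The filter `G` on `P` is generic over `M`: it meets every dense subset of `P` that is an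
element of `M`. -/
def IsGenericOver (P : SetPoset.{u}) (G : Order.PFilter P.Cond) (M : ZFSet.{u}) : Prop :=
  ∀ D ∈ M, D ⊆ P.carrier → Forcing.IsDense (P.condsIn D) → ∃ p ∈ G, p.1 ∈ D

/-- `P`-names: sets all of whose elements are pairs `(σ, p)` of a `P`-name and a condition. -/
inductive IsName (P : SetPoset.{u}) : ZFSet.{u} → Prop
  | mk (τ : ZFSet.{u}) (pairs : ∀ z ∈ τ, ∃ σ, ∃ p ∈ P.carrier, z = ZFSet.pair σ p)
      (names : ∀ σ p, ZFSet.pair σ p ∈ τ → IsName P σ) : IsName P τ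

end SetPoset

theorem mem_of_pair_mem {σ p τ : ZFSet.{u}} (h : ZFSet.pair σ p ∈ τ) :
    σ ∈ ZFSet.sUnion (ZFSet.sUnion τ) := by
  rw [ZFSet.mem_sUnion]
  refine ⟨{σ}, ?_, by simp⟩
  rw [ZFSet.mem_sUnion]
  exact ⟨_, h, by simp [ZFSet.pair]⟩

theorem rank_lt_of_pair_mem {σ p τ : ZFSet.{u}} (h : ZFSet.pair σ p ∈ τ) : σ.rank < τ.rank := by
  have h1 : ({σ} : ZFSet.{u}) ∈ ZFSet.pair σ p := by simp [ZFSet.pair]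
  have h2 : σ ∈ ({σ} : ZFSet.{u}) := by simp
  exact (ZFSet.rank_lt_of_mem h2).trans ((ZFSet.rank_lt_of_mem h1).trans (ZFSet.rank_lt_of_mem h))

instance small_evalIndex (G : Set ZFSet.{u}) (τ : ZFSet.{u}) :
    Small.{u} {σ : ZFSet.{u} // ∃ p ∈ G, ZFSet.pair σ p ∈ τ} :=
  small_of_injective (β := {σ : ZFSet.{u} // σ ∈ ZFSet.sUnion (ZFSet.sUnion τ)})
    (f := fun σ => ⟨σ.1, by obtain ⟨_, p, -, h⟩ := σ; exact mem_of_pair_mem h⟩)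
    (fun σ₁ σ₂ e => Subtype.ext (congrArg (fun x => x.1) e))

/-- The value of the name `τ` under `G`, by recursion: `τ^G = {σ^G | (σ, p) ∈ τ for a p ∈ G}`. -/
noncomputable def nameVal (G : Set ZFSet.{u}) (τ : ZFSet.{u}) : ZFSet.{u} :=
  ZFSet.range fun σ : {σ : ZFSet.{u} // ∃ p ∈ G, ZFSet.pair σ p ∈ τ} => nameVal G σ.1
termination_by τ.rank
decreasing_by
  obtain ⟨σ, p, -, h⟩ := σ
  exact rank_lt_of_pair_mem h

theorem mem_nameVal {G : Set ZFSet.{u}} {τ x : ZFSet.{u}} :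
    x ∈ nameVal G τ ↔ ∃ σ, ∃ p ∈ G, ZFSet.pair σ p ∈ τ ∧ nameVal G σ = x := by
  rw [nameVal, ZFSet.mem_range]
  constructor
  · rintro ⟨⟨σ, p, hp, h⟩, e⟩
    exact ⟨σ, p, hp, h, e⟩
  · rintro ⟨σ, p, hp, h, e⟩
    exact ⟨⟨σ, p, hp, h⟩, e⟩

/-- The forcing extension `M[G]`: the values of the `P`-names that are elements of `M`. -/
def forcingExtension (M : ZFSet.{u}) (P : SetPoset.{u}) (G : Order.PFilter P.Cond) :
    Set ZFSet.{u} :=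
  {x | ∃ τ ∈ M, P.IsName τ ∧ nameVal {p | ∃ q ∈ G, q.1 = p} τ = x}

/-- `H_κ`: the sets whose transitive closure has size less than `κ`, that is, the sets
contained in a transitive set of size less than `κ`. -/
def hereditarilySmaller (κ : Cardinal.{u}) : Set ZFSet.{u} :=
  {x | ∃ t : ZFSet.{u}, t.IsTransitive ∧ x ⊆ t ∧ t.card < κ}

/-- The set `H` is a ccc forcing extension of `M`. -/
def IsCCCForcingExtension (H : Set ZFSet.{u}) (M : ZFSet.{u}) : Prop :=
  ∃ P : SetPoset.{u}, P.MemModel M ∧ P.CCCIn M ∧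
    ∃ G : Order.PFilter P.Cond, P.IsGenericOver G M ∧ forcingExtension M P G = H

/-- The local grounded Martin's Axiom: there are a cardinal `κ ≥ 𝔠` and a transitive `ZFC⁻` model
`M ⊆ H_{κ⁺}` such that `H_{κ⁺}` is a ccc forcing extension of `M` and the conclusion of Martin's
Axiom holds in `V` for all posets `Q ∈ M` that are ccc in `V`. -/
def LocalGroundedMA : Prop :=
  ∃ κ : Cardinal.{u}, 𝔠 ≤ κ ∧ ∃ M : ZFSet.{u}, M.IsTransitive ∧
    SetLang.ModelsZFCMinus (fun x y : {x : ZFSet.{u} // x ∈ M} => x.1 ∈ y.1) ∧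
    (∀ x ∈ M, x ∈ hereditarilySmaller (Order.succ κ)) ∧
    IsCCCForcingExtension (hereditarilySmaller (Order.succ κ)) M ∧
    ∀ Q : SetPoset.{u}, Q.MemModel M → Forcing.CCC Q.Cond → Forcing.MartinConclusion Q.Cond

/-! ### Finite partial functions into `Bool` -/

namespace Forcing

universe v w

/-! The ordinal `κ.ord` lies in `H_{κ⁺} = M[G]`, so it is the value of some name `τ ∈ M`. Distinct
elements of a value come from distinct elements of the name (`card_nameVal_le`), hence `τ` itself is
a set of `M` with at least `κ ≥ 𝔠` elements. The name thus supplies a large index set in the ground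
model, with no need to compute cardinals or ordinals of `M`.

The model contains a copy of the finite partial functions from `τ` to `2`
(`IsModel.exists_cohen_poset`). Finiteness is absolute, so this copy has all the conditions that `V`
sees, and it is ccc in `V` (`FinPartial.ccc`); the grounded axiom applies to it.

Finally, one index set of size at least `𝔠` suffices for all (`FinPartial.martinConclusion`): by the
ccc, fewer than `𝔠` dense sets involve, through maximal antichains, fewer than `𝔠` coordinates, and
these embed into the large index set. -/

/-- The finite partial functions from `I` to `2`. -/
def FinPartial (I : Type v) : Type v := {p : I → Option Bool // {x | p x ≠ none}.Finite}

instance (I : Type v) : Preorder (FinPartial I) where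
  le q p := ∀ x b, p.1 x = some b → q.1 x = some b
  le_refl _ _ _ h := h
  le_trans _ _ _ h₁ h₂ x b h := h₁ x b (h₂ x b h)

open MeasureTheory in
/-- Finite partial functions form a ccc poset: incompatible conditions determine disjoint
cylinders of positive measure in `I → Bool`. -/
theorem FinPartial.ccc (I : Type v) : CCC (FinPartial I) := by
  classical
  intro A hA
  let μ : Measure Bool := (PMF.uniformOfFintype Bool).toMeasure
  let C : A → Set (I → Bool) := fun p =>
    (↑p.1.2.toFinset : Set I).pi fun i => {b | p.1.1 i = some b}
  have hC (p : A) (g : I → Bool) : g ∈ C p ↔ ∀ i, p.1.1 i ≠ none → p.1.1 i = some (g i) := by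
    simp [C, Set.mem_pi]
  have hpos : {p : A | 0 < Measure.infinitePi (fun _ : I => μ) (C p)} = Set.univ := by
    refine Set.eq_univ_of_forall fun p => ?_
    change 0 < Measure.infinitePi (fun _ : I => μ) (C p)
    rw [Measure.infinitePi_pi _ fun _ _ => MeasurableSet.of_discrete, pos_iff_ne_zero,
      Finset.prod_ne_zero_iff]
    intro i hi
    obtain ⟨b, hb⟩ : ∃ b, p.1.1 i = some b := Option.ne_none_iff_exists'.1 (by simpa using hi)
    have : {b' | p.1.1 i = some b'} = {b} := by
      ext b'
      simp [hb, eq_comm]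
    rw [this, PMF.toMeasure_apply_singleton _ _ (measurableSet_singleton b)]
    simp
  have := Measure.countable_meas_pos_of_disjoint_iUnion
    (μ := Measure.infinitePi (fun _ : I => μ)) (As := C)
    (fun p => MeasurableSet.pi (Finset.countable_toSet _) fun _ _ => MeasurableSet.of_discrete) ?_
  · rw [hpos, Set.countable_univ_iff] at this
    exact Set.countable_coe_iff.1 this
  · intro p q hpq
    refine Set.disjoint_left.2 fun g hp hq => hA p.2 q.2 (Subtype.coe_injective.ne hpq) ?_
    rw [hC] at hp hq
    -- A point `g` in both cylinders, restricted to the union of the two domains, is a common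
    -- extension.
    refine ⟨⟨fun i => if p.1.1 i ≠ none ∨ q.1.1 i ≠ none then some (g i) else none,
      (p.1.2.union q.1.2).subset fun i hi => ?_⟩, fun i b h => ?_, fun i b h => ?_⟩
    · by_contra h
      simp_all
    · have := hp i (by simp [h])
      simp_all
    · have := hq i (by simp [h])
      simp_all

/-! ### Transfer of the chain condition and of Martin's Axiom between posets -/

variable {P : Type v} {Q : Type w} [Preorder P] [Preorder Q]

/-- Compatibility pulls back along `f`. Injectivity of `f` is not required: two conditions with the
same image are compatible, so `f` is injective on every antichain. -/
theorem CCC.of_reflecting (hQ : CCC Q) (f : P → Q) (hf : ∀ p q, f p ≤ f q ↔ p ≤ q)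
    (hs : Function.Surjective f) : CCC P := by
  have hcomp (p q) (h : Compatible (f p) (f q)) : Compatible p q := by
    obtain ⟨r, hp, hq⟩ := h
    obtain ⟨r, rfl⟩ := hs r
    exact ⟨r, (hf _ _).1 hp, (hf _ _).1 hq⟩
  intro A hA
  have hinj : Set.InjOn f A := fun p hp q hq e => by
    by_contra hne
    exact hA hp hq hne (hcomp _ _ ⟨f p, le_rfl, e.le⟩)
  refine Set.countable_of_injective_of_countable_image hinj (hQ _ ?_)
  rintro _ ⟨p, hp, rfl⟩ _ ⟨q, hq, rfl⟩ hne h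
  exact hA hp hq (fun e => hne (congrArg f e)) (hcomp _ _ h)

/-- If `g` is monotone and dense sets of `Q` "pull back" to dense sets of `P`, the conclusion of
Martin's Axiom passes from `P` to a family of dense sets of `Q`. -/
theorem MartinConclusion.exists_filter (hP : MartinConclusion P) (g : P → Q) (hg : Monotone g)
    (𝒟 : Set (Set Q)) (h𝒟 : #𝒟 < 𝔠)
    (hd : ∀ D ∈ 𝒟, IsDense {p : P | ∃ d ∈ D, g p ≤ d}) :
    ∃ G : Order.PFilter Q, ∀ D ∈ 𝒟, ∃ p ∈ G, p ∈ D := by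
  obtain ⟨G, hG⟩ := hP ((fun D => {p : P | ∃ d ∈ D, g p ≤ d}) '' 𝒟) (by
      have := mk_image_le_lift (f := fun D => {p : P | ∃ d ∈ D, g p ≤ d}) (s := 𝒟)
      rw [← lift_lt.{_, w}]
      refine this.trans_lt ?_
      rw [lift_continuum, ← lift_continuum.{v, w}, lift_lt]
      exact h𝒟)
    (by rintro _ ⟨D, hD, rfl⟩; exact hd D hD)
  have hF : Order.IsPFilter {q : Q | ∃ p ∈ G, g p ≤ q} := by
    refine Order.IsPFilter.of_def ?_ ?_ ?_
    · obtain ⟨p, hp⟩ := G.nonempty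
      exact ⟨g p, p, hp, le_rfl⟩
    · rintro a ⟨p, hp, ha⟩ b ⟨q, hq, hb⟩
      obtain ⟨r, hr, hrp, hrq⟩ := G.directed p hp q hq
      exact ⟨g r, ⟨r, hr, le_rfl⟩, (hg hrp).trans ha, (hg hrq).trans hb⟩
    · rintro a b hab ⟨p, hp, ha⟩
      exact ⟨p, hp, ha.trans hab⟩
  refine ⟨hF.toPFilter, fun D hD => ?_⟩
  obtain ⟨p, hp, d, hd, hpd⟩ := hG _ ⟨D, hD, rfl⟩
  exact ⟨d, ⟨p, hp, hpd⟩, hd⟩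

theorem MartinConclusion.of_reflecting (hP : MartinConclusion P) (f : P → Q)
    (hf : ∀ p q, f p ≤ f q ↔ p ≤ q) (hs : Function.Surjective f) : MartinConclusion Q := by
  intro 𝒟 h𝒟 hd
  refine hP.exists_filter f (fun p q h => (hf p q).2 h) 𝒟 h𝒟 fun D hD p => ?_
  obtain ⟨d, hdD, hdp⟩ := hd D hD (f p)
  obtain ⟨q, rfl⟩ := hs d
  exact ⟨q, ⟨_, hdD, le_rfl⟩, (hf _ _).1 hdp⟩

/-- Every dense set contains an antichain such that every condition is compatible with one of its
members. -/
theorem IsDense.exists_predense_antichain {D : Set P} (hD : IsDense D) :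
    ∃ A ⊆ D, IsForcingAntichain A ∧ ∀ p, ∃ a ∈ A, Compatible a p := by
  obtain ⟨A, -, hA⟩ := zorn_subset_nonempty {A | A ⊆ D ∧ IsForcingAntichain A}
    (fun c hc hchain _ => ⟨⋃₀ c, ⟨Set.sUnion_subset fun A hA => (hc hA).1,
      (Set.pairwise_sUnion hchain.directedOn).2 fun A hA => (hc hA).2⟩,
      fun A hA => Set.subset_sUnion_of_mem hA⟩) ∅ ⟨Set.empty_subset _, Set.pairwise_empty _⟩
  refine ⟨A, hA.prop.1, hA.prop.2, fun p => ?_⟩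
  obtain ⟨d, hd, hdp⟩ := hD p
  by_contra! hcon
  have hda (a) (ha : a ∈ A) : ¬ Compatible a d := by
    rintro ⟨r, hra, hrd⟩
    exact hcon a ha ⟨r, hra, hrd.trans hdp⟩
  have hmem : d ∈ A := by
    refine hA.le_of_ge (y := insert d A) ⟨Set.insert_subset hd hA.prop.1, ?_⟩
      (Set.subset_insert _ _) (Set.mem_insert _ _)
    refine hA.prop.2.insert fun a ha _ => ⟨fun ⟨r, h₁, h₂⟩ => hda a ha ⟨r, h₂, h₁⟩, hda a ha⟩
  exact hda d hmem ⟨d, le_rfl, le_rfl⟩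

/-- Martin's Axiom for the finite partial functions on one set of size at least continuum gives it
for the finite partial functions on every set. -/
theorem FinPartial.martinConclusion {X : Type w} (hX : 𝔠 ≤ #X)
    (h : MartinConclusion (FinPartial X)) (I : Type v) : MartinConclusion (FinPartial I) := by
  classical
  intro 𝒟 h𝒟 hd
  choose! A hAD hA hApre using fun D (hD : D ∈ 𝒟) => (hd D hD).exists_predense_antichain
  -- All coordinates mentioned by the chosen antichains.
  let S : Set I := ⋃ D : 𝒟, ⋃ a : A D.1, {i | a.1.1 i ≠ none}
  have hS : #S < 𝔠 := by
    refine (mk_iUnion_le_sum_mk.trans (sum_le_sum _ (fun _ => ℵ₀) fun D => ?_)).trans_lt ?_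
    · have : Countable (A D.1) := (FinPartial.ccc I _ (hA D.1 D.2)).to_subtype
      exact (Set.countable_iUnion fun a => a.1.2.countable).le_aleph0
    · rw [sum_const, lift_id, lift_id]
      -- Each `D` contributes only countably many coordinates, so a product bound is enough and
      -- regularity of `𝔠` plays no role.
      exact mul_lt_of_lt aleph0_le_continuum h𝒟 aleph0_lt_continuum
  obtain ⟨e⟩ : Nonempty (S ↪ X) := by
    rw [← lift_mk_le']
    refine (lift_le.2 hS.le).trans ?_
    rw [lift_continuum, ← lift_continuum.{v, w}]
    exact lift_le.2 hX
  -- `g` reads a condition back along `e` and leaves coordinates outside `S` undefined.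
  let g : FinPartial X → FinPartial I := fun q =>
    ⟨fun i => if hi : i ∈ S then q.1 (e ⟨i, hi⟩) else none, by
      refine ((q.2.preimage e.injective.injOn).image Subtype.val).subset fun i hi => ?_
      by_cases hiS : i ∈ S
      · exact ⟨⟨i, hiS⟩, by simpa [hiS] using hi, rfl⟩
      · simp [hiS] at hi⟩
  refine h.exists_filter g (fun q r hqr i b hb => ?_) 𝒟 h𝒟 fun D hD q => ?_
  · by_cases hiS : i ∈ S
    · simp only [g, hiS, dite_true] at hb ⊢
      exact hqr _ _ hb
    · simp [g, hiS] at hb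
  · obtain ⟨a, ha, r, hra, hrq⟩ := hApre D hD (g q)
    -- Copy `r` onto the range of `e` and keep `q` elsewhere. Then `q'` extends `q` because `r ≤ g
    -- q`, and `g q'` extends `a` because the domain of `a` lies in `S`.
    let q' : FinPartial X := ⟨Function.extend e (fun i => r.1 i.1) q.1, by
      refine (q.2.union ((r.2.preimage Subtype.val_injective.injOn).image e)).subset
        fun x hx => ?_
      by_cases hxe : ∃ i, e i = x
      · obtain ⟨i, rfl⟩ := hxe
        rw [Set.mem_ofPred_eq, e.injective.extend_apply] at hx
        exact .inr ⟨i, hx, rfl⟩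
      · rw [Set.mem_ofPred_eq, Function.extend_apply' _ _ _ hxe] at hx
        exact .inl hx⟩
    refine ⟨q', ⟨a, hAD D hD ha, fun i b hb => ?_⟩, fun x b hb => ?_⟩
    · have hi : i ∈ S := Set.mem_iUnion.2 ⟨⟨D, hD⟩, Set.mem_iUnion.2 ⟨⟨a, ha⟩, by simp [hb]⟩⟩
      simp only [g, q', hi, dite_true, e.injective.extend_apply]
      exact hra i b hb
    · by_cases hxe : ∃ i, e i = x
      · obtain ⟨i, rfl⟩ := hxe
        simp only [q', e.injective.extend_apply]
        refine hrq _ _ ?_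
        simpa [g] using hb
      · simpa only [q', Function.extend_apply' _ _ _ hxe] using hb

end Forcing

/-! ### Definability in a transitive model -/

namespace TransitiveModel

open FirstOrder Language SetLang

/-- The elements of `M`. -/
abbrev Elt (M : ZFSet.{u}) : Type (u + 1) := {x : ZFSet.{u} // x ∈ M}

instance (M : ZFSet.{u}) : SetLang.lang.Structure (Elt M) := struc fun x y => x.1 ∈ y.1

/-- The relation `R` on `M` is first-order definable with parameters from `M`. -/
def DefinableIn (M : ZFSet.{u}) (n : ℕ) (R : (Fin n → Elt M) → Prop) : Prop :=
  ∃ φ : SetLang.lang.Formula (Elt M ⊕ Fin n), ∀ v, φ.Realize (Sum.elim id v) ↔ R v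

/-- The operation `t` on `M` has values in `M` and a definable graph. -/
def TermIn (M : ZFSet.{u}) (n : ℕ) (t : (Fin n → Elt M) → ZFSet.{u}) : Prop :=
  (∀ v, t v ∈ M) ∧ DefinableIn M (n + 1) fun v => (v 0).1 = t fun i => v i.succ

variable {M : ZFSet.{u}} {n : ℕ}

namespace DefinableIn

theorem imp {R S : (Fin n → Elt M) → Prop} (hR : DefinableIn M n R) (hS : DefinableIn M n S) :
    DefinableIn M n fun v => R v → S v := by
  obtain ⟨φ, hφ⟩ := hR
  obtain ⟨ψ, hψ⟩ := hS
  exact ⟨φ.imp ψ, fun v => by rw [Formula.realize_imp, hφ, hψ]⟩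

theorem not {R : (Fin n → Elt M) → Prop} (hR : DefinableIn M n R) :
    DefinableIn M n fun v => ¬ R v := by
  obtain ⟨φ, hφ⟩ := hR
  exact ⟨φ.not, fun v => by rw [Formula.realize_not, hφ]⟩

theorem and {R S : (Fin n → Elt M) → Prop} (hR : DefinableIn M n R) (hS : DefinableIn M n S) :
    DefinableIn M n fun v => R v ∧ S v := by
  obtain ⟨φ, hφ⟩ := hR
  obtain ⟨ψ, hψ⟩ := hS
  exact ⟨φ ⊓ ψ, fun v => by rw [Formula.realize_inf, hφ, hψ]⟩

theorem or {R S : (Fin n → Elt M) → Prop} (hR : DefinableIn M n R) (hS : DefinableIn M n S) :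
    DefinableIn M n fun v => R v ∨ S v := by
  obtain ⟨φ, hφ⟩ := hR
  obtain ⟨ψ, hψ⟩ := hS
  exact ⟨φ ⊔ ψ, fun v => by rw [Formula.realize_sup, hφ, hψ]⟩

theorem iff {R S : (Fin n → Elt M) → Prop} (hR : DefinableIn M n R) (hS : DefinableIn M n S) :
    DefinableIn M n fun v => R v ↔ S v := by
  simpa only [iff_iff_implies_and_implies] using (hR.imp hS).and (hS.imp hR)

/-- Convention for all quantifiers below: the bound variable gets index `0` and the others are
shifted up by one. -/
theorem ex {R : (Fin n → Elt M) → Elt M → Prop}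
    (hR : DefinableIn M (n + 1) fun v => R (fun i => v i.succ) (v 0)) :
    DefinableIn M n fun v => ∃ x, R v x := by
  obtain ⟨φ, hφ⟩ := hR
  let g : Elt M ⊕ Fin (n + 1) → (Elt M ⊕ Fin n) ⊕ Unit :=
    Sum.elim (fun c => .inl (.inl c)) (Fin.cons (.inr ()) fun i => .inl (.inr i))
  have key (v : Fin n → Elt M) (w : Unit → Elt M) :
      Sum.elim (Sum.elim id v) w ∘ g = Sum.elim id (Fin.cons (w ()) v) := by
    funext a
    rcases a with c | i
    · rfl
    · refine Fin.cases ?_ (fun i => ?_) i <;> simp [g]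
  refine ⟨(φ.relabel g).iExs Unit, fun v => ?_⟩
  rw [Formula.realize_iExs]
  constructor
  · rintro ⟨w, hw⟩
    rw [Formula.realize_relabel, key, hφ] at hw
    exact ⟨w (), by simpa using hw⟩
  · rintro ⟨x, hx⟩
    refine ⟨fun _ => x, ?_⟩
    rw [Formula.realize_relabel, key, hφ]
    simpa using hx

theorem all {R : (Fin n → Elt M) → Elt M → Prop}
    (hR : DefinableIn M (n + 1) fun v => R (fun i => v i.succ) (v 0)) :
    DefinableIn M n fun v => ∀ x, R v x := by
  simpa only [not_exists, not_not] using (ex (R := fun v x => ¬ R v x) hR.not).not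

theorem reindex {m : ℕ} {R : (Fin n → Elt M) → Prop} (hR : DefinableIn M n R)
    (f : Fin n → Fin m) : DefinableIn M m fun v => R fun i => v (f i) := by
  obtain ⟨φ, hφ⟩ := hR
  refine ⟨φ.relabel (Sum.map id f), fun v => ?_⟩
  have : Sum.elim id v ∘ Sum.map id f = Sum.elim id fun i => v (f i) := by
    funext a
    rcases a with c | i <;> rfl
  rw [Formula.realize_relabel, this]
  exact hφ _

theorem mem_var (i j : Fin n) : DefinableIn M n fun v => (v i).1 ∈ (v j).1 :=
  ⟨Relations.formula₂ (L := SetLang.lang) RelSymbol.mem (Term.var (.inr i)) (Term.var (.inr j)),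
    fun _ => Formula.realize_rel₂⟩

theorem eq_var (i j : Fin n) : DefinableIn M n fun v => (v i).1 = (v j).1 :=
  ⟨Term.equal (Term.var (.inr i)) (Term.var (.inr j)), fun v => by
    rw [Formula.realize_equal, Subtype.ext_iff]; rfl⟩

theorem eq_const (i : Fin n) (c : Elt M) : DefinableIn M n fun v => (v i).1 = c.1 :=
  ⟨Term.equal (Term.var (.inr i)) (Term.var (.inl c)), fun v => by
    rw [Formula.realize_equal, Subtype.ext_iff]; rfl⟩

end DefinableIn

theorem TermIn.var (i : Fin n) : TermIn M n fun v => (v i).1 :=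
  ⟨fun v => (v i).2, DefinableIn.eq_var 0 i.succ⟩

theorem TermIn.const {c : ZFSet.{u}} (hc : c ∈ M) : TermIn M n fun _ => c :=
  ⟨fun _ => hc, DefinableIn.eq_const 0 ⟨c, hc⟩⟩

/-- Substitution of a definable operation for a variable. -/
theorem DefinableIn.subst {R : (Fin n → Elt M) → ZFSet.{u} → Prop} {t : (Fin n → Elt M) → ZFSet.{u}}
    (ht : TermIn M n t) (hR : DefinableIn M (n + 1) fun v => R (fun i => v i.succ) (v 0).1) :
    DefinableIn M n fun v => R v (t v) := by
  have := DefinableIn.ex (R := fun v x => x.1 = t v ∧ R v x.1) (ht.2.and hR)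
  convert this using 2 with v
  exact ⟨fun h => ⟨⟨t v, ht.1 v⟩, rfl, h⟩, fun ⟨x, hx, h⟩ => hx ▸ h⟩

theorem TermIn.lift {t : (Fin n → Elt M) → ZFSet.{u}} (ht : TermIn M n t) :
    TermIn M (n + 1) fun v => t fun i => v i.succ := by
  refine ⟨fun v => ht.1 _, ?_⟩
  have := ht.2.reindex (Fin.cons 0 fun i => i.succ.succ : Fin (n + 1) → Fin (n + 1 + 1))
  simpa using this

namespace DefinableIn

variable {s t : (Fin n → Elt M) → ZFSet.{u}}

theorem mem (hs : TermIn M n s) (ht : TermIn M n t) : DefinableIn M n fun v => s v ∈ t v :=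
  subst (R := fun v x => x ∈ t v) hs <|
    subst (R := fun v x => (v 0).1 ∈ x) ht.lift (mem_var 1 0)

theorem eq (hs : TermIn M n s) (ht : TermIn M n t) : DefinableIn M n fun v => s v = t v :=
  subst (R := fun v x => x = t v) hs <|
    subst (R := fun v x => (v 0).1 = x) ht.lift (eq_var 1 0)

end DefinableIn

/-- `M` is a transitive model of `ZFC⁻`. -/
structure IsModel (M : ZFSet.{u}) : Prop where
  transitive : M.IsTransitive
  zfc : ModelsZFCMinus fun x y : Elt M => x.1 ∈ y.1

/-- Parameters can be listed as finitely many additional variables. -/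
theorem DefinableIn.exists_formula {R : (Fin n → Elt M) → Prop} (hR : DefinableIn M n R) :
    ∃ (k : ℕ) (φ : SetLang.lang.Formula (Fin n ⊕ Fin k)) (c : Fin k → Elt M),
      ∀ v, φ.Realize (Sum.elim v c) ↔ R v := by
  classical
  obtain ⟨φ, hφ⟩ := hR
  let P := φ.freeVarFinset.toLeft
  let e := P.equivFin
  refine ⟨P.card, BoundedFormula.restrictFreeVar φ fun a => match a with
    | ⟨.inl c, h⟩ => .inr (e ⟨c, by simpa [P] using h⟩)
    | ⟨.inr i, _⟩ => .inl i, fun i => (e.symm i).1, fun v => ?_⟩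
  rw [← hφ]
  refine BoundedFormula.realize_restrictFreeVar _ ?_
  rintro ⟨c | i, h⟩ <;> simp

/-! ### Closure of the model under set operations -/

namespace IsModel

theorem mem_of_mem (hM : IsModel M) {x y : ZFSet.{u}} (hx : x ∈ y) (hy : y ∈ M) : x ∈ M :=
  hM.transitive y hy hx

/-- Definability constrains `R` only on `M`. By transitivity, the set that `M` obtains from
separation has the same elements in `V`. -/
theorem sep_mem (hM : IsModel M) {R : ZFSet.{u} → Prop}
    (hR : DefinableIn M 1 fun v => R (v 0).1) {a : ZFSet.{u}} (ha : a ∈ M) :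
    ZFSet.sep R a ∈ M := by
  obtain ⟨k, φ, c, hφ⟩ := hR.exists_formula
  obtain ⟨b, hb⟩ := hM.zfc.separation k
    (φ.relabel (Sum.elim (fun _ => 0) Fin.succ)) c ⟨a, ha⟩
  have hS (x : Elt M) : Sat (fun x y : Elt M => x.1 ∈ y.1)
      (φ.relabel (Sum.elim (fun _ => 0) Fin.succ)) (Fin.cons x c) ↔ R x.1 := by
    refine Iff.trans ?_ (hφ fun _ => x)
    refine Formula.realize_relabel.trans (Eq.to_iff (congrArg _ ?_))
    funext a
    rcases a with i | i <;> simp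
  convert b.2
  ext x
  rw [ZFSet.mem_sep]
  constructor
  · rintro ⟨hx, h⟩
    exact (hb ⟨x, hM.mem_of_mem hx ha⟩).2 ⟨hx, (hS _).2 h⟩
  · intro hx
    have := (hb ⟨x, hM.mem_of_mem hx b.2⟩).1 hx
    exact ⟨this.1, (hS _).1 this.2⟩

theorem collection (hM : IsModel M) {R : ZFSet.{u} → ZFSet.{u} → Prop}
    (hR : DefinableIn M 2 fun v => R (v 0).1 (v 1).1) {a : ZFSet.{u}} (ha : a ∈ M)
    (h : ∀ x ∈ a, ∃ y ∈ M, R x y) : ∃ b ∈ M, ∀ x ∈ a, ∃ y ∈ b, R x y := by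
  obtain ⟨k, φ, c, hφ⟩ := hR.exists_formula
  have hS (x y : Elt M) : Sat (fun x y : Elt M => x.1 ∈ y.1)
      (φ.relabel (Sum.elim (Fin.cons 0 fun _ => 1) fun i => i.succ.succ))
      (Fin.cons x (Fin.cons y c)) ↔ R x.1 y.1 := by
    refine Iff.trans ?_ (hφ (Fin.cons x fun _ => y))
    refine Formula.realize_relabel.trans (Eq.to_iff (congrArg _ ?_))
    funext a
    rcases a with i | i
    · refine Fin.cases rfl (fun _ => rfl) i
    · simp
  obtain ⟨b, hb⟩ := hM.zfc.collection k _ c ⟨a, ha⟩ fun x hx => by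
    obtain ⟨y, hy, hxy⟩ := h x.1 hx
    exact ⟨⟨y, hy⟩, (hS _ _).2 hxy⟩
  refine ⟨b, b.2, fun x hx => ?_⟩
  obtain ⟨y, hy, hxy⟩ := hb ⟨x, hM.mem_of_mem hx ha⟩ hx
  exact ⟨y, hy, (hS _ _).1 hxy⟩

theorem sUnion_mem (hM : IsModel M) {x : ZFSet.{u}} (hx : x ∈ M) : ZFSet.sUnion x ∈ M := by
  obtain ⟨y, hy⟩ := hM.zfc.union ⟨x, hx⟩
  convert y.2
  ext z
  rw [ZFSet.mem_sUnion]
  constructor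
  · rintro ⟨w, hw, hz⟩
    have hwM := hM.mem_of_mem hw hx
    exact (hy ⟨z, hM.mem_of_mem hz hwM⟩).2 ⟨⟨w, hwM⟩, hw, hz⟩
  · intro hz
    obtain ⟨w, hw, hz⟩ := (hy ⟨z, hM.mem_of_mem hz y.2⟩).1 hz
    exact ⟨w.1, hw, hz⟩

theorem unordered_pair_mem (hM : IsModel M) {x y : ZFSet.{u}} (hx : x ∈ M) (hy : y ∈ M) :
    ({x, y} : ZFSet.{u}) ∈ M := by
  obtain ⟨z, hz⟩ := hM.zfc.pairing ⟨x, hx⟩ ⟨y, hy⟩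
  convert z.2
  ext w
  rw [ZFSet.mem_pair]
  constructor
  · rintro (rfl | rfl)
    · exact (hz ⟨w, hx⟩).2 (.inl rfl)
    · exact (hz ⟨w, hy⟩).2 (.inr rfl)
  · intro hw
    simpa [Subtype.ext_iff] using (hz ⟨w, hM.mem_of_mem hw z.2⟩).1 hw

theorem singleton_mem (hM : IsModel M) {x : ZFSet.{u}} (hx : x ∈ M) : ({x} : ZFSet.{u}) ∈ M := by
  simpa using hM.unordered_pair_mem hx hx

theorem insert_mem (hM : IsModel M) {x y : ZFSet.{u}} (hx : x ∈ M) (hy : y ∈ M) :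
    insert x y ∈ M := by
  rw [ZFSet.insert_eq, ← ZFSet.sUnion_pair]
  exact hM.sUnion_mem (hM.unordered_pair_mem (hM.singleton_mem hx) hy)

theorem pair_mem (hM : IsModel M) {x y : ZFSet.{u}} (hx : x ∈ M) (hy : y ∈ M) :
    ZFSet.pair x y ∈ M :=
  hM.unordered_pair_mem (hM.singleton_mem hx) (hM.unordered_pair_mem hx hy)

/-- `M` contains the empty set and an inductive set. -/
theorem exists_inductive (hM : IsModel M) :
    ∅ ∈ M ∧ ∃ x ∈ M, ∅ ∈ x ∧ ∀ y ∈ x, insert y y ∈ x := by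
  obtain ⟨x, ⟨e, hex, he⟩, hx⟩ := hM.zfc.infinity
  have he0 : e.1 = ∅ := by
    rw [ZFSet.eq_empty]
    exact fun y hy => he ⟨y, hM.mem_of_mem hy e.2⟩ hy
  refine ⟨he0 ▸ e.2, x, x.2, he0 ▸ hex, fun y hy => ?_⟩
  obtain ⟨s, hs, hys⟩ := hx ⟨y, hM.mem_of_mem hy x.2⟩ hy
  convert hs
  ext z
  rw [ZFSet.mem_insert_iff]
  constructor
  · intro h
    have hz : z ∈ M := by
      rcases h with rfl | h
      · exact hM.mem_of_mem hy x.2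
      · exact hM.mem_of_mem h (hM.mem_of_mem hy x.2)
    exact (hys ⟨z, hz⟩).2 (by simpa [Subtype.ext_iff, or_comm] using h)
  · intro h
    simpa [Subtype.ext_iff, or_comm] using (hys ⟨z, hM.mem_of_mem h s.2⟩).1 h

theorem empty_mem (hM : IsModel M) : ∅ ∈ M := hM.exists_inductive.1

end IsModel

namespace TermIn

variable {s t : (Fin n → Elt M) → ZFSet.{u}}

/-- The graph is defined by extensionality with a quantifier over `M`; transitivity makes testing
elements of `M` sufficient. -/
theorem insert (hM : IsModel M) (hs : TermIn M n s) (ht : TermIn M n t) :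
    TermIn M n fun v => insert (s v) (t v) := by
  refine ⟨fun v => hM.insert_mem (hs.1 v) (ht.1 v), ?_⟩
  have := DefinableIn.all (n := n + 1)
    (R := fun v z => z.1 ∈ (v 0).1 ↔ z.1 = s (fun i => v i.succ) ∨ z.1 ∈ t (fun i => v i.succ))
    ((DefinableIn.mem_var 0 1).iff
      ((DefinableIn.eq (.var 0) hs.lift.lift).or (.mem (.var 0) ht.lift.lift)))
  convert this using 2 with v
  constructor
  · intro h z
    rw [h, ZFSet.mem_insert_iff]
  · intro h
    ext z
    rw [ZFSet.mem_insert_iff]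
    constructor
    · exact fun hz => (h ⟨z, hM.mem_of_mem hz (v 0).2⟩).1 hz
    · intro hz
      have hzM : z ∈ M := by
        rcases hz with rfl | hz
        · exact hs.1 _
        · exact hM.mem_of_mem hz (ht.1 _)
      exact (h ⟨z, hzM⟩).2 hz

theorem singleton (hM : IsModel M) (hs : TermIn M n s) : TermIn M n fun v => {s v} := by
  simpa using hs.insert hM (.const hM.empty_mem)

theorem pair (hM : IsModel M) (hs : TermIn M n s) (ht : TermIn M n t) :
    TermIn M n fun v => ZFSet.pair (s v) (t v) :=
  (hs.singleton hM).insert hM ((hs.insert hM (ht.singleton hM)).singleton hM)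

end TermIn

namespace IsModel

/-- Images of sets under definable binary operations. -/
theorem exists_image2 (hM : IsModel M) {F : ZFSet.{u} → ZFSet.{u} → ZFSet.{u}}
    (hF : TermIn M 2 fun v => F (v 0).1 (v 1).1) {A B : ZFSet.{u}} (hA : A ∈ M) (hB : B ∈ M) :
    ∃ C ∈ M, ∀ z, z ∈ C ↔ ∃ a ∈ A, ∃ b ∈ B, z = F a b := by
  have hFM {a b : ZFSet.{u}} (ha : a ∈ M) (hb : b ∈ M) : F a b ∈ M := by
    simpa using hF.1 ![⟨a, ha⟩, ⟨b, hb⟩]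
  have graph {k : ℕ} (i j l : Fin k) :
      DefinableIn M k fun v => (v l).1 = F (v i).1 (v j).1 := by
    simpa using! hF.2.reindex ![l, i, j]
  -- Two rounds of collection: first over `b` for a fixed `a`, then over `a` to gather the resulting
  -- sets `Y`. Collection yields only supersets, so the image is cut out of `⋃ W` by separation.
  have hrow (a) (ha : a ∈ A) : ∃ Y ∈ M, ∀ b : Elt M, b.1 ∈ B →
      ∃ y : Elt M, y.1 ∈ Y ∧ y.1 = F a b.1 := by
    have haM := hM.mem_of_mem ha hA
    obtain ⟨Y, hY, h⟩ := hM.collection (R := fun b y => y = F a b)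
      (DefinableIn.subst (R := fun v x => (v 1).1 = F x (v 0).1) (.const haM) (graph 0 1 2)) hB
      fun b hb => ⟨_, hFM haM (hM.mem_of_mem hb hB), rfl⟩
    refine ⟨Y, hY, fun b hb => ?_⟩
    obtain ⟨y, hy, e⟩ := h b.1 hb
    exact ⟨⟨y, hM.mem_of_mem hy hY⟩, hy, e⟩
  obtain ⟨W, hW, h⟩ := hM.collection (R := fun a Y => ∀ b : Elt M, b.1 ∈ B →
      ∃ y : Elt M, y.1 ∈ Y ∧ y.1 = F a b.1)
    (.all (.imp (.mem (.var 0) (.const hB)) (.ex (.and (.mem_var 0 3) (graph 2 1 0))))) hA hrow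
  refine ⟨ZFSet.sep (fun z => ∃ a : Elt M, a.1 ∈ A ∧ ∃ b : Elt M, b.1 ∈ B ∧ z = F a.1 b.1)
    (ZFSet.sUnion W), hM.sep_mem (.ex (.and (.mem (.var 0) (.const hA))
      (.ex (.and (.mem (.var 0) (.const hB)) (graph 1 0 2))))) (hM.sUnion_mem hW), fun z => ?_⟩
  rw [ZFSet.mem_sep, ZFSet.mem_sUnion]
  constructor
  · rintro ⟨-, a, ha, b, hb, e⟩
    exact ⟨a, ha, b, hb, e⟩
  · rintro ⟨a, ha, b, hb, rfl⟩
    obtain ⟨Y, hY, h⟩ := h a ha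
    obtain ⟨y, hy, e⟩ := h ⟨b, hM.mem_of_mem hb hB⟩ hb
    exact ⟨⟨Y, hY, e ▸ hy⟩, ⟨a, hM.mem_of_mem ha hA⟩, ha, ⟨b, hM.mem_of_mem hb hB⟩, hb, rfl⟩

theorem prod_mem (hM : IsModel M) {A B : ZFSet.{u}} (hA : A ∈ M) (hB : B ∈ M) :
    ZFSet.prod A B ∈ M := by
  obtain ⟨C, hC, h⟩ := hM.exists_image2 (F := ZFSet.pair) ((TermIn.var 0).pair hM (.var 1)) hA hB
  convert hC
  ext z
  rw [ZFSet.mem_prod, h]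

end IsModel

end TransitiveModel

namespace TransitiveModel

/-! ### The set of finite subsets of a set of the model -/

variable {M : ZFSet.{u}}

/-- Some `t ∈ M` contains the pair `(n, s)`, and each of its members is `(∅, ∅)` or obtained from
another member `(k, r)` as `(k + 1, r ∪ {x})` with `x ∈ X`. So `n` is a natural number and `s`
a subset of `X` with at most `n` elements. -/
def IsCounted (M X n s : ZFSet.{u}) : Prop :=
  ∃ t : Elt M, ZFSet.pair n s ∈ t.1 ∧ ∀ z : Elt M, z.1 ∈ t.1 → z.1 = ZFSet.pair ∅ ∅ ∨
    ∃ k r x : Elt M, ZFSet.pair k.1 r.1 ∈ t.1 ∧ x.1 ∈ X ∧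
      z.1 = ZFSet.pair (insert k.1 k.1) (insert x.1 r.1)

theorem DefinableIn.isCounted (hM : IsModel M) {X : ZFSet.{u}} (hX : X ∈ M) {m : ℕ} (i j : Fin m) :
    DefinableIn M m fun v => IsCounted M X (v i).1 (v j).1 := by
  have h₀ := hM.empty_mem
  refine .ex (.and (.mem (.pair hM (.var _) (.var _)) (.var _)) (.all (.imp (.mem_var _ _)
    (.or (.eq (.var _) (.pair hM (.const h₀) (.const h₀))) (.ex (.ex (.ex
      (.and (.mem (.pair hM (.var _) (.var _)) (.var _)) (.and (.mem (.var _) (.const hX))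
        (.eq (.var _) (.pair hM (.insert hM (.var _) (.var _))
          (.insert hM (.var _) (.var _)))))))))))))

theorem insert_self_inj {a b : ZFSet.{u}} (h : insert a a = insert b b) : a = b := by
  have h₁ : a ∈ insert b b := h ▸ ZFSet.mem_insert a a
  have h₂ : b ∈ insert a a := h ▸ ZFSet.mem_insert b b
  rw [ZFSet.mem_insert_iff] at h₁ h₂
  rcases h₁ with h₁ | h₁
  · exact h₁
  · rcases h₂ with h₂ | h₂
    · exact h₂.symm
    · exact absurd h₁ (ZFSet.mem_asymm h₂)

theorem insert_ne_empty (a b : ZFSet.{u}) : insert a b ≠ ∅ := fun h =>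
  ZFSet.notMem_empty a (h ▸ ZFSet.mem_insert a b)

theorem IsCounted.cases (hM : IsModel M) {X n s : ZFSet.{u}} (h : IsCounted M X n s) :
    (n = ∅ ∧ s = ∅) ∨ ∃ k r x, IsCounted M X k r ∧ x ∈ X ∧ n = insert k k ∧ s = insert x r := by
  obtain ⟨t, hns, ht⟩ := h
  rcases ht ⟨_, hM.mem_of_mem hns t.2⟩ hns with h | ⟨k, r, x, hkr, hx, h⟩
  · exact .inl (ZFSet.pair_inj.1 h)
  · exact .inr ⟨k, r, x, ⟨t, hkr, ht⟩, hx, ZFSet.pair_inj.1 h⟩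

theorem isCounted_empty (hM : IsModel M) (X : ZFSet.{u}) : IsCounted M X ∅ ∅ :=
  ⟨⟨_, hM.singleton_mem (hM.pair_mem hM.empty_mem hM.empty_mem)⟩, by simp,
    fun z hz => .inl (by simpa using hz)⟩

theorem IsCounted.insert (hM : IsModel M) {X n s x : ZFSet.{u}} (h : IsCounted M X n s)
    (hn : n ∈ M) (hs : s ∈ M) (hX : X ∈ M) (hx : x ∈ X) :
    IsCounted M X (insert n n) (insert x s) := by
  obtain ⟨t, hns, ht⟩ := h
  have hxM := hM.mem_of_mem hx hX
  refine ⟨⟨_, hM.insert_mem (hM.pair_mem (hM.insert_mem hn hn) (hM.insert_mem hxM hs)) t.2⟩,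
    ZFSet.mem_insert _ _, fun z hz => ?_⟩
  rcases ZFSet.mem_insert_iff.1 hz with hz | hz
  · exact .inr ⟨⟨n, hn⟩, ⟨s, hs⟩, ⟨x, hxM⟩, ZFSet.mem_insert_of_mem _ hns, hx, hz⟩
  · rcases ht z hz with h | ⟨k, r, y, h, hy, e⟩
    · exact .inl h
    · exact .inr ⟨k, r, y, ZFSet.mem_insert_of_mem _ h, hy, e⟩

/-- Well-founded `∈`-induction in `V`: the predecessor `k` is an element of `n = k ∪ {k}`, so
descending along the witness must end at `(∅, ∅)`. -/
theorem IsCounted.finite (hM : IsModel M) {X n s : ZFSet.{u}} (h : IsCounted M X n s) :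
    (s : Set ZFSet.{u}).Finite ∧ s ⊆ X := by
  induction n using ZFSet.inductionOn generalizing s with
  | _ n ih =>
    rcases h.cases hM with ⟨-, rfl⟩ | ⟨k, r, x, hkr, hx, rfl, rfl⟩
    · simp
    · obtain ⟨hfin, hsub⟩ := ih k (ZFSet.mem_insert k k) hkr
      refine ⟨by rw [ZFSet.coe_insert]; exact hfin.insert x, fun y hy => ?_⟩
      rcases ZFSet.mem_insert_iff.1 hy with rfl | hy
      · exact hx
      · exact hsub hy

/-- The finite subsets of a set of the model form a set of the model. -/
theorem IsModel.exists_finite_subsets (hM : IsModel M) {X : ZFSet.{u}} (hX : X ∈ M) :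
    ∃ F ∈ M, ∀ s, s ∈ F ↔ (s : Set ZFSet.{u}).Finite ∧ s ⊆ X := by
  obtain ⟨-, I, hI, hI₀, hIs⟩ := hM.exists_inductive
  -- Without power sets, finite subsets cannot be separated from a power set. Instead `y` bounds the
  -- level of subsets counted by `n`; `J` collects the `n ∈ I` whose level is bounded. Since `J` is
  -- inductive, it covers every finite size, and collection over `J` bounds all these levels at
  -- once.
  let φ (n y : ZFSet.{u}) : Prop := ∀ s : Elt M, IsCounted M X n s.1 → s.1 ∈ y
  have hφ {m : ℕ} (i j : Fin m) : DefinableIn M m fun v => φ (v i).1 (v j).1 :=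
    .all (.imp (.isCounted hM hX _ _) (.mem_var _ _))
  let J := ZFSet.sep (fun n => ∃ y : Elt M, φ n y.1) I
  have hJ : J ∈ M := hM.sep_mem (.ex (hφ 1 0)) hI
  have hJ₀ : ∅ ∈ J := by
    refine ZFSet.mem_sep.2 ⟨hI₀, ⟨_, hM.singleton_mem hM.empty_mem⟩, fun s hs => ?_⟩
    rcases hs.cases hM with ⟨-, h⟩ | ⟨k, r, x, -, -, h, -⟩
    · simp [h]
    · exact absurd h.symm (insert_ne_empty k k)
  have hJs (n) (hn : n ∈ J) : insert n n ∈ J := by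
    obtain ⟨hnI, y, hy⟩ := ZFSet.mem_sep.1 hn
    -- The next level is bounded by the sets `r ∪ {x}` with `x ∈ X` and `r ∈ y`.
    obtain ⟨C, hC, h⟩ := hM.exists_image2 (F := insert) (.insert hM (.var 0) (.var 1)) hX y.2
    refine ZFSet.mem_sep.2 ⟨hIs n hnI, ⟨C, hC⟩, fun s hs => ?_⟩
    rcases hs.cases hM with ⟨h, -⟩ | ⟨k, r, x, hkr, hx, e, hs'⟩
    · exact absurd h (insert_ne_empty n n)
    · obtain rfl := insert_self_inj e
      have hr : r ∈ M := by
        obtain ⟨t, ht, -⟩ := hkr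
        have h₁ : ({n, r} : ZFSet.{u}) ∈ M :=
          hM.mem_of_mem (by simp [ZFSet.pair]) (hM.mem_of_mem ht t.2)
        exact hM.mem_of_mem (by simp) h₁
      exact (h _).2 ⟨x, hx, r, hy ⟨r, hr⟩ hkr, hs'⟩
  obtain ⟨b, hb, h⟩ := hM.collection (hφ 0 1) hJ fun n hn => by
    obtain ⟨-, y, hy⟩ := ZFSet.mem_sep.1 hn
    exact ⟨y, y.2, hy⟩
  refine ⟨ZFSet.sep (fun s => ∃ n : Elt M, IsCounted M X n.1 s) (ZFSet.sUnion b),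
    hM.sep_mem (.ex (.isCounted hM hX 0 1)) (hM.sUnion_mem hb), fun s => ?_⟩
  rw [ZFSet.mem_sep, ZFSet.mem_sUnion]
  constructor
  · rintro ⟨-, n, hn⟩
    exact hn.finite hM
  · rintro ⟨hfin, hsub⟩
    have key (A : Set ZFSet.{u}) (hA : A.Finite) : A ⊆ X →
        ∃ s ∈ M, (s : Set ZFSet.{u}) = A ∧ ∃ n ∈ J, IsCounted M X n s := by
      induction A, hA using Set.Finite.induction_on with
      | empty => exact fun _ => ⟨∅, hM.empty_mem, by simp, ∅, hJ₀, isCounted_empty hM X⟩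
      | @insert x A _ _ ih =>
        intro hA
        obtain ⟨s, hs, rfl, n, hn, hc⟩ := ih ((Set.subset_insert _ _).trans hA)
        have hx : x ∈ X := hA (Set.mem_insert _ _)
        exact ⟨insert x s, hM.insert_mem (hM.mem_of_mem hx hX) hs, by simp, _, hJs n hn,
          hc.insert hM (hM.mem_of_mem hn hJ) hs hX hx⟩
    obtain ⟨s', hs', e, n, hn, hc⟩ := key s hfin hsub
    obtain rfl := SetLike.coe_injective e
    obtain ⟨y, hy, hyφ⟩ := h n hn
    exact ⟨⟨y, hy, hyφ ⟨s', hs'⟩ hc⟩, ⟨n, hM.mem_of_mem hn hJ⟩, hc⟩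

end TransitiveModel

namespace TransitiveModel

open Forcing

variable {M : ZFSet.{u}}

/-! ### Cohen forcing in the model -/

/-- The set coding a truth value. -/
def boolCode (b : Bool) : ZFSet.{u} := if b then {∅} else ∅

theorem boolCode_injective : Function.Injective boolCode.{u} := by
  have h : ({∅} : ZFSet.{u}) ≠ ∅ := by
    rw [← insert_empty_eq]
    exact insert_ne_empty _ _
  intro a b
  cases a <;> cases b <;> simp [boolCode, h, h.symm]

/-- For every set `X` of the model, the model contains a copy of the poset of finite partial
functions from `X` to `2`. -/
theorem IsModel.exists_cohen_poset (hM : IsModel M) {X : ZFSet.{u}} (hX : X ∈ M) :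
    ∃ Q : SetPoset.{u}, Q.MemModel M ∧ ∃ f : Q.Cond → FinPartial {x : ZFSet.{u} // x ∈ X},
      (∀ p q, f p ≤ f q ↔ p ≤ q) ∧ Function.Surjective f := by
  classical
  have hcode (b : Bool) : boolCode b ∈ M := by
    cases b
    · exact hM.empty_mem
    · exact hM.singleton_mem hM.empty_mem
  have hY : ZFSet.prod X {boolCode true, boolCode false} ∈ M :=
    hM.prod_mem hX (hM.unordered_pair_mem (hcode _) (hcode _))
  obtain ⟨F, hF, hFmem⟩ := hM.exists_finite_subsets hY
  -- Conditions are coded by their graphs: finite sets of pairs giving no point both values.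
  let C := ZFSet.sep (fun p => ∀ x : Elt M, ZFSet.pair x.1 (boolCode true) ∈ p →
    ¬ ZFSet.pair x.1 (boolCode false) ∈ p) F
  have hC : C ∈ M := hM.sep_mem (.all (.imp (.mem (.pair hM (.var 0) (.const (hcode _))) (.var 1))
    (.not (.mem (.pair hM (.var 0) (.const (hcode _))) (.var 1))))) hF
  let r := ZFSet.sep (fun z => ∃ q p : Elt M, z = ZFSet.pair q.1 p.1 ∧
    ∀ y : Elt M, y.1 ∈ p.1 → y.1 ∈ q.1) (ZFSet.prod C C)
  have hr : r ∈ M := hM.sep_mem (.ex (.ex (.and (.eq (.var 2) (.pair hM (.var 1) (.var 0)))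
    (.all (.imp (.mem_var 0 1) (.mem_var 0 2)))))) (hM.prod_mem hC hC)
  have hrmem (q p) : ZFSet.pair q p ∈ r ↔ q ∈ C ∧ p ∈ C ∧ p ⊆ q := by
    rw [ZFSet.mem_sep, ZFSet.pair_mem_prod, and_assoc]
    refine and_congr_right fun hq => and_congr_right fun hp => ?_
    constructor
    · rintro ⟨q', p', e, h⟩ y hy
      obtain ⟨rfl, rfl⟩ := ZFSet.pair_inj.1 e
      exact h ⟨y, hM.mem_of_mem hy p'.2⟩ hy
    · exact fun h => ⟨⟨q, hM.mem_of_mem hq hC⟩, ⟨p, hM.mem_of_mem hp hC⟩, rfl, fun y hy => h hy⟩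
  have hCmem (p) : p ∈ C ↔ ((p : Set ZFSet.{u}).Finite ∧
      p ⊆ ZFSet.prod X {boolCode true, boolCode false}) ∧
      ∀ x, ZFSet.pair x (boolCode true) ∈ p → ¬ ZFSet.pair x (boolCode false) ∈ p := by
    rw [ZFSet.mem_sep, hFmem]
    refine and_congr_right fun hp => ⟨fun h x hx => ?_, fun h x => h x.1⟩
    exact h ⟨x, hM.mem_of_mem (ZFSet.pair_mem_prod.1 (hp.2 hx)).1 hX⟩ hx
  let Q : SetPoset.{u} :=
    { carrier := C
      rel := r
      rel_subset := ZFSet.sep_subset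
      nonempty := ⟨∅, (hCmem ∅).2 (by simp)⟩
      refl := fun p hp => (hrmem p p).2 ⟨hp, hp, subset_rfl⟩
      trans := fun p q s h₁ h₂ => by
        rw [hrmem] at h₁ h₂ ⊢
        exact ⟨h₁.1, h₂.2.1, h₂.2.2.trans h₁.2.2⟩ }
  let f (p : Q.Cond) (x : {x : ZFSet.{u} // x ∈ X}) : Option Bool :=
    if ZFSet.pair x.1 (boolCode true) ∈ p.1 then some true
    else if ZFSet.pair x.1 (boolCode false) ∈ p.1 then some false else none
  have hf (p : Q.Cond) (x b) : f p x = some b ↔ ZFSet.pair x.1 (boolCode b) ∈ p.1 := by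
    have h := ((hCmem p.1).1 p.2).2 x.1
    cases b <;> simp only [f] <;> split_ifs <;> simp_all
  have hfin (p : Q.Cond) : {x | f p x ≠ none}.Finite := by
    have hpf := ((hCmem p.1).1 p.2).1.1
    refine (Set.finite_iUnion fun b => hpf.preimage (f := fun x : {x : ZFSet.{u} // x ∈ X} =>
      ZFSet.pair x.1 (boolCode b)) fun x _ y _ e => Subtype.ext (ZFSet.pair_inj.1 e).1).subset
      fun x hx => ?_
    obtain ⟨b, hb⟩ := Option.ne_none_iff_exists'.1 hx
    exact Set.mem_iUnion.2 ⟨b, (hf p x b).1 hb⟩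
  refine ⟨Q, hM.pair_mem hC hr, fun p => ⟨f p, hfin p⟩, fun p q => ?_, fun g => ?_⟩
  · change (∀ x b, f q x = some b → f p x = some b) ↔ ZFSet.pair p.1 q.1 ∈ r
    simp only [hf, hrmem]
    refine ⟨fun h => ⟨p.2, q.2, fun y hy => ?_⟩, fun h x b hb => h.2.2 hb⟩
    obtain ⟨x, hx, c, hc, rfl⟩ := ZFSet.mem_prod.1 (((hCmem q.1).1 q.2).1.2 hy)
    rcases ZFSet.mem_pair.1 hc with rfl | rfl
    · exact h ⟨x, hx⟩ _ hy
    · exact h ⟨x, hx⟩ _ hy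
  · have : Finite {x // g.1 x ≠ none} := g.2
    -- The index type lives in universe `u + 1`; smallness, from finiteness, lets its range be a
    -- set.
    have : Small.{u} {x // g.1 x ≠ none} := Countable.toSmall _
    -- The graph of `g`. The default `true` is never taken, since `g` is defined at every index
    -- used.
    let p : ZFSet.{u} := ZFSet.range fun x : {x // g.1 x ≠ none} =>
      ZFSet.pair x.1.1 (boolCode ((g.1 x.1).getD true))
    have hp (x : {x : ZFSet.{u} // x ∈ X}) (b) :
        ZFSet.pair x.1 (boolCode b) ∈ p ↔ g.1 x = some b := by
      rw [ZFSet.mem_range]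
      constructor
      · rintro ⟨⟨y, hy⟩, e⟩
        obtain ⟨e₁, e₂⟩ := ZFSet.pair_inj.1 e
        obtain rfl := Subtype.ext e₁
        obtain ⟨c, hc⟩ := Option.ne_none_iff_exists'.1 hy
        have := boolCode_injective e₂
        simp_all
      · intro h
        exact ⟨⟨x, by simp [h]⟩, by simp [h]⟩
    have hpC : p ∈ C := by
      have hsub : p ⊆ ZFSet.prod X {boolCode true, boolCode false} := by
        intro z hz
        obtain ⟨x, rfl⟩ := ZFSet.mem_range.1 hz
        refine ZFSet.pair_mem_prod.2 ⟨x.1.2, ZFSet.mem_pair.2 ?_⟩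
        cases (g.1 x.1).getD true <;> simp
      refine (hCmem p).2 ⟨⟨?_, hsub⟩, fun x h₁ h₂ => ?_⟩
      · rw [ZFSet.coe_range]
        exact Set.finite_range _
      · have hx := (ZFSet.pair_mem_prod.1 (hsub h₁)).1
        have h₁ := (hp ⟨x, hx⟩ _).1 h₁
        have h₂ := (hp ⟨x, hx⟩ _).1 h₂
        simp [h₁] at h₂
    refine ⟨⟨p, hpC⟩, Subtype.ext (funext fun x => Option.ext fun b => ?_)⟩
    exact (hf ⟨p, hpC⟩ x b).trans (hp x b)

end TransitiveModel

/-! ### Names and the size of the model -/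

/-- A name has at least as many elements as its value. -/
theorem card_nameVal_le (G : Set ZFSet.{u}) (τ : ZFSet.{u}) : (nameVal G τ).card ≤ τ.card := by
  rw [← lift_le.{u + 1}, ← ZFSet.cardinalMk_coe_sort, ← ZFSet.cardinalMk_coe_sort]
  choose σ p _ hτ hval using fun x : {x // x ∈ nameVal G τ} => mem_nameVal.1 x.2
  refine mk_le_of_injective (f := fun x : {x // x ∈ nameVal G τ} =>
    (⟨ZFSet.pair (σ x) (p x), hτ x⟩ : {z // z ∈ τ})) fun x y e => ?_
  have h : σ x = σ y := (ZFSet.pair_inj.1 (congrArg Subtype.val e)).1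
  exact Subtype.ext (by rw [← hval x, ← hval y, h])

theorem ord_toZFSet_mem_hereditarilySmaller (κ : Cardinal.{u}) :
    κ.ord.toZFSet ∈ hereditarilySmaller (Order.succ κ) :=
  ⟨_, (ZFSet.isOrdinal_toZFSet _).isTransitive, subset_rfl, by
    rw [Ordinal.card_toZFSet, card_ord]
    exact Order.lt_succ κ⟩

theorem mainTheorem10 (h : LocalGroundedMA.{u}) : MACohen.{u} := by
  obtain ⟨κ, hκ, M, htrans, hzfc, -, ⟨P, -, -, G, -, hext⟩, hMA⟩ := h
  have hM : TransitiveModel.IsModel M := ⟨htrans, hzfc⟩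
  obtain ⟨τ, hτ, -, hval⟩ : κ.ord.toZFSet ∈ forcingExtension M P G :=
    hext ▸ ord_toZFSet_mem_hereditarilySmaller κ
  have hcard : κ ≤ τ.card := by
    simpa [hval] using card_nameVal_le {p | ∃ q ∈ G, q.1 = p} τ
  obtain ⟨Q, hQ, f, hf, hs⟩ := hM.exists_cohen_poset hτ
  have hQMA := hMA Q hQ ((Forcing.FinPartial.ccc _).of_reflecting f hf hs)
  intro lam
  refine Forcing.FinPartial.martinConclusion ?_ (hQMA.of_reflecting f hf hs)
    (lam.ord.ToType × ℕ)
  -- The type of elements of `τ` is one universe up, so its cardinality is the lift of `τ.card`.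
  refine le_of_le_of_eq ?_ (ZFSet.cardinalMk_coe_sort (x := τ)).symm
  rw [← lift_continuum.{u + 1, u}, lift_le]
  exact hκ.trans hcard
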